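/- For irrational $x\in(0,1)$ let $x=[a_1(x),a_2(x),\dots]$ be its continued fraction expansion, that is, $a_n(x)=\lfloor 1/T^{n-1}(x)\rfloor$ for $n\ge 1$, where $T:[0,1)\to[0,1)$ is the Gauss map, $T(0)=0$ and $T(x)=1/x-\lfloor 1/x\rfloor$ for $x\in(0,1)$. Put $S_n(x)=\sum_{i=1}^{n}a_i(x)a_{i+1}(x)$, and for $\phi:\mathbb N\to\mathbb R_+$ put $$E(\phi)=\Big\{x\in(0,1)\setminus\mathbb Q:\ \lim_{n\to\infty}\frac{S_n(x)}{\phi(n)}=1\Big\}.$$ **Theorem.** For every real $\alpha>1$, if $\phi(n)=e^{\alpha^n}$, then $$\dim_{\mathcal H}E(\phi)=\frac{1}{1+\alpha},$$ where $\dim_{\mathcal H}$ denotes Hausdorff dimension. -/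

import Mathlib

/-- The Gauss map: `T 0 = 0` and `T x = 1 / x - ⌊1 / x⌋` for `x ≠ 0`
(at `x = 0` the convention `1 / 0 = 0` gives the value `0`). It is only used on `[0, 1)`. -/
noncomputable def gaussMap (x : ℝ) : ℝ := 1 / x - (⌊1 / x⌋ : ℝ)

/-- The `n`-th partial quotient `a_n(x) = ⌊1 / T ^ (n - 1) x⌋` for `n ≥ 1` of the continued fraction
expansion of an irrational `x ∈ (0, 1)`. The index `n = 0` is never used. -/
noncomputable def partialQuotient (n : ℕ) (x : ℝ) : ℤ := ⌊1 / (gaussMap^[n - 1] x)⌋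

/-- The sum `S_n(x) = ∑_{i = 1}^{n} a_i(x) * a_{i + 1}(x)` of products of consecutive
partial quotients. -/
noncomputable def productSum (n : ℕ) (x : ℝ) : ℤ :=
  ∑ i ∈ Finset.Icc 1 n, partialQuotient i x * partialQuotient (i + 1) x

/-- The set `E(φ)` of the irrational `x ∈ (0, 1)` with `S_n(x) / φ(n) → 1`. -/
def growthSet (φ : ℕ → ℝ) : Set ℝ :=
  {x : ℝ | x ∈ Set.Ioo (0 : ℝ) 1 ∧ Irrational x ∧
    Filter.Tendsto (fun n : ℕ => (productSum n x : ℝ) / φ n) Filter.atTop (nhds 1)}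

open Filter Topology

/-! Since `exp (α ^ n)` is negligible against `exp (α ^ (n + 1))`, the last summand dominates `S_n`,
and membership in the set means exactly `a_n a_{n+1} ~ exp (α ^ n)` (`tendsto_productSum_div_iff`).
Taking logarithms turns this into a linear recursion with bounded error, whose solutions are `log
a_n = α ^ n / (1 + α) + O(n)`. Errors linear in `n` do not affect dimension, because all estimates
below are exponentials of multiples of `α ^ n`.

Upper bound (`dimH_logBandSet_le`): cover by the points sharing their first `n` partial quotients.
With `c = 1 / (1 + α)` and `L = c * ∑_{i ≤ n} α ^ i`, there are about `exp L` such pieces. Each has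
diameter at most about `exp (-2 L - c * α ^ (n + 1))`, the last term coming from the forced size of
the next quotient. As `L` is about `c * α ^ (n + 1) / (α - 1)`, the critical exponent is `1 / ((α -
1) + 2) = 1 / (1 + α)`.

Lower bound (`le_dimH_growthSet`): write `y ∈ [0, 1)` in a mixed radix system and use its digits to
perturb the quotients around `exp (c * α ^ n)`. The resulting points lie in the set, and recovering
`y` is Hölder of every positive exponent `r < 1 / (1 + α)` (`dist_le_of_partialQuotient_eq`). As
`[0, 1)` has dimension one, the set has dimension at least `r`. -/

/-! ### Gauss map orbits and distances between points with common quotients -/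

theorem irrational_gaussMap {x : ℝ} (hx : Irrational x) : Irrational (gaussMap x) := by
  unfold gaussMap
  rw [one_div]
  exact hx.inv.sub_intCast _

theorem Irrational.gaussMap_mem_Ioo {x : ℝ} (hx : Irrational x) :
    gaussMap x ∈ Set.Ioo (0 : ℝ) 1 := by
  refine ⟨lt_of_le_of_ne ?_ (irrational_gaussMap hx).ne_zero.symm, ?_⟩
  · exact Int.fract_nonneg _
  · exact Int.fract_lt_one _

theorem irrational_iterate_gaussMap {x : ℝ} (hx : Irrational x) (n : ℕ) :
    Irrational (gaussMap^[n] x) := by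
  induction n with
  | zero => exact hx
  | succ n ih => rw [Function.iterate_succ_apply']; exact irrational_gaussMap ih

theorem iterate_gaussMap_mem_Ioo {x : ℝ} (hx : Irrational x) (h01 : x ∈ Set.Ioo (0 : ℝ) 1)
    (n : ℕ) : gaussMap^[n] x ∈ Set.Ioo (0 : ℝ) 1 := by
  cases n with
  | zero => exact h01
  | succ n =>
    rw [Function.iterate_succ_apply']
    exact (irrational_iterate_gaussMap hx n).gaussMap_mem_Ioo

theorem partialQuotient_succ (n : ℕ) (x : ℝ) :
    partialQuotient (n + 1) x = ⌊1 / gaussMap^[n] x⌋ := rfl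

theorem one_le_floor_one_div {x : ℝ} (hx : x ∈ Set.Ioo (0 : ℝ) 1) : 1 ≤ ⌊1 / x⌋ := by
  rw [Int.le_floor, Int.cast_one, le_div_iff₀ hx.1]
  linarith [hx.2]

theorem le_one_div_floor {x : ℝ} (hx : x ∈ Set.Ioo (0 : ℝ) 1) : x ≤ 1 / (⌊1 / x⌋ : ℝ) := by
  have h1 : (1 : ℝ) ≤ (⌊1 / x⌋ : ℝ) := by exact_mod_cast one_le_floor_one_div hx
  rw [le_div_iff₀ (by linarith), mul_comm, ← le_div_iff₀ hx.1]
  exact Int.floor_le _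

theorem one_div_floor_add_one_le {x : ℝ} (hx : x ∈ Set.Ioo (0 : ℝ) 1) :
    1 / ((⌊1 / x⌋ : ℝ) + 1) ≤ x := by
  have h1 : (1 : ℝ) ≤ (⌊1 / x⌋ : ℝ) := by exact_mod_cast one_le_floor_one_div hx
  rw [div_le_iff₀ (by linarith), mul_comm, ← div_le_iff₀ hx.1]
  exact (Int.lt_floor_add_one _).le

theorem one_le_partialQuotient_succ {x : ℝ} (hx : ∀ n, gaussMap^[n] x ∈ Set.Ioo (0 : ℝ) 1)
    (n : ℕ) : 1 ≤ partialQuotient (n + 1) x :=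
  one_le_floor_one_div (hx n)

/-- If `x` and `y` have the same first partial quotient, then the Gauss map stretches their
distance by the factor `1 / (x * y)`. -/
theorem abs_sub_eq_gaussMap {x y : ℝ} (hx : 0 < x) (hy : 0 < y)
    (h : ⌊1 / x⌋ = ⌊1 / y⌋) : |x - y| = |gaussMap x - gaussMap y| * (x * y) := by
  have h1 : gaussMap x - gaussMap y = (y - x) / (x * y) := by
    unfold gaussMap
    rw [h]
    field_simp
    ring
  rw [h1, abs_div, abs_of_pos (mul_pos hx hy), div_mul_cancel₀ _ (mul_pos hx hy).ne',
    abs_sub_comm]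

/-- Each Gauss step divides distances by the product of the two points, and each point is at most
the reciprocal of its quotient. -/
theorem abs_sub_le_of_partialQuotient_eq {x y : ℝ} {l : ℕ → ℝ}
    (hx : ∀ n, gaussMap^[n] x ∈ Set.Ioo (0 : ℝ) 1) (hy : ∀ n, gaussMap^[n] y ∈ Set.Ioo (0 : ℝ) 1)
    (n : ℕ) (h : ∀ i < n, partialQuotient (i + 1) x = partialQuotient (i + 1) y)
    (hl : ∀ i < n, Real.exp (l i) ≤ partialQuotient (i + 1) x) :
    |x - y| ≤ |gaussMap^[n] x - gaussMap^[n] y| * Real.exp (-2 * ∑ i ∈ Finset.range n, l i) := by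
  induction n with
  | zero => simp
  | succ n ih =>
    refine (ih (fun i hi => h i (by omega)) (fun i hi => hl i (by omega))).trans ?_
    have key : ∀ z, z ∈ Set.Ioo (0 : ℝ) 1 → Real.exp (l n) ≤ (⌊1 / z⌋ : ℝ) →
        z ≤ Real.exp (- l n) := fun z hz hz' => by
      rw [Real.exp_neg, ← one_div]
      exact (le_one_div_floor hz).trans (one_div_le_one_div_of_le (Real.exp_pos _) hz')
    have hn := h n (by omega)
    have hln := hl n (by omega)
    rw [abs_sub_eq_gaussMap (hx n).1 (hy n).1 hn, Function.iterate_succ_apply',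
      Function.iterate_succ_apply', Finset.sum_range_succ, mul_add, Real.exp_add, mul_assoc]
    refine mul_le_mul_of_nonneg_left ?_ (abs_nonneg _)
    rw [mul_comm]
    refine mul_le_mul_of_nonneg_left ?_ (Real.exp_pos _).le
    calc _ ≤ Real.exp (- l n) * Real.exp (- l n) :=
          mul_le_mul (key _ (hx n) hln) (key _ (hy n) (by rw [hn] at hln; exact hln))
            (hy n).1.le (Real.exp_pos _).le
      _ = _ := by rw [← Real.exp_add]; ring_nf

theorem le_abs_sub_of_partialQuotient_eq {x y : ℝ} {u : ℕ → ℝ}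
    (hx : ∀ n, gaussMap^[n] x ∈ Set.Ioo (0 : ℝ) 1) (hy : ∀ n, gaussMap^[n] y ∈ Set.Ioo (0 : ℝ) 1)
    (n : ℕ) (h : ∀ i < n, partialQuotient (i + 1) x = partialQuotient (i + 1) y)
    (hu : ∀ i < n, (partialQuotient (i + 1) x : ℝ) + 1 ≤ Real.exp (u i)) :
    |gaussMap^[n] x - gaussMap^[n] y| * Real.exp (-2 * ∑ i ∈ Finset.range n, u i) ≤ |x - y| := by
  induction n with
  | zero => simp
  | succ n ih =>
    refine le_trans ?_ (ih (fun i hi => h i (by omega)) (fun i hi => hu i (by omega)))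
    have key : ∀ z, z ∈ Set.Ioo (0 : ℝ) 1 → (⌊1 / z⌋ : ℝ) + 1 ≤ Real.exp (u n) →
        Real.exp (- u n) ≤ z := fun z hz hz' => by
      rw [Real.exp_neg, ← one_div]
      have h1 : (1 : ℝ) ≤ (⌊1 / z⌋ : ℝ) := by exact_mod_cast one_le_floor_one_div hz
      exact (one_div_le_one_div_of_le (by linarith) hz').trans (one_div_floor_add_one_le hz)
    have hn := h n (by omega)
    have hun := hu n (by omega)
    rw [abs_sub_eq_gaussMap (hx n).1 (hy n).1 hn, Function.iterate_succ_apply',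
      Function.iterate_succ_apply', Finset.sum_range_succ, mul_add, Real.exp_add, mul_assoc]
    refine mul_le_mul_of_nonneg_left ?_ (abs_nonneg _)
    rw [mul_comm]
    refine mul_le_mul_of_nonneg_right ?_ (Real.exp_pos _).le
    calc _ = Real.exp (- u n) * Real.exp (- u n) := by rw [← Real.exp_add]; ring_nf
      _ ≤ _ := mul_le_mul (key _ (hx n) hun) (key _ (hy n) (by rw [hn] at hun; exact hun))
            (Real.exp_pos _).le (hx n).1.le

/-- A number whose orbit under the Gauss map never reaches `0` is irrational. -/
theorem irrational_of_iterate_gaussMap_mem_Ioo {x : ℝ}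
    (hx : ∀ n, gaussMap^[n] x ∈ Set.Ioo (0 : ℝ) 1) : Irrational x := by
  -- Infinite descent on the denominator: the Gauss map sends `p / q` to a fraction with denominator
  -- `p < q`.
  have key : ∀ q : ℕ, ∀ x : ℝ, (∀ n, gaussMap^[n] x ∈ Set.Ioo (0 : ℝ) 1) →
      ∀ p : ℤ, x ≠ p / q := by
    intro q
    induction q using Nat.strong_induction_on with
    | _ q ih =>
      intro x hx p hp
      have h0 : x ∈ Set.Ioo (0 : ℝ) 1 := hx 0
      have hq : (0 : ℝ) < q := by
        rcases Nat.eq_zero_or_pos q with h | h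
        · subst h; simp at hp; exact absurd hp h0.1.ne'
        · exact_mod_cast h
      have hpx : (p : ℝ) = x * q := by rw [hp]; field_simp
      have hp0 : (0 : ℝ) < p := by rw [hpx]; exact mul_pos h0.1 hq
      have hpq : (p : ℝ) < q := by rw [hpx]; nlinarith [h0.2]
      obtain ⟨p', rfl⟩ := Int.eq_ofNat_of_zero_le (by exact_mod_cast hp0.le : 0 ≤ p)
      refine ih p' (by exact_mod_cast hpq) (gaussMap x) (fun n => ?_)
        (q - p' * ⌊1 / x⌋) ?_
      · rw [← Function.iterate_succ_apply]; exact hx (n + 1)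
      · have : 1 / x = q / p' := by rw [hp]; simp
        rw [gaussMap]
        push_cast at hp0 ⊢
        rw [this]
        field_simp
  rintro ⟨q, rfl⟩
  exact key q.den q hx q.num (by exact_mod_cast (Rat.num_div_den q).symm)

/-! ### Numbers with prescribed partial quotients -/

/-- The value of the finite continued fraction `[a 0, …, a (n - 1)]`. -/
noncomputable def finiteContFract : ℕ → (ℕ → ℕ) → ℝ
  | 0, _ => 0
  | n + 1, a => 1 / (a 0 + finiteContFract n (fun i => a (i + 1)))

theorem one_div_add_mem_Icc {k : ℕ} (hk : 2 ≤ k) {u : ℝ} (hu : 0 ≤ u) :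
    1 / (k + u) ∈ Set.Icc (0 : ℝ) (1 / 2) := by
  have : (2 : ℝ) ≤ k := by exact_mod_cast hk
  exact ⟨by positivity, one_div_le_one_div_of_le (by norm_num) (by linarith)⟩

theorem finiteContFract_mem_Icc (n : ℕ) (a : ℕ → ℕ) (ha : ∀ i, 2 ≤ a i) :
    finiteContFract n a ∈ Set.Icc (0 : ℝ) (1 / 2) := by
  induction n generalizing a with
  | zero => simp [finiteContFract]
  | succ n ih => exact one_div_add_mem_Icc (ha 0) (ih _ fun i => ha (i + 1)).1

/-- The map `u ↦ 1 / (a + u)` with `a ≥ 2` and `u ≥ 0` contracts distances by at least the factor `1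
/ 2`. -/
theorem dist_finiteContFract_le (n : ℕ) (a : ℕ → ℕ) (ha : ∀ i, 2 ≤ a i) :
    dist (finiteContFract n a) (finiteContFract (n + 1) a) ≤ 1 * (1 / 2) ^ n := by
  induction n generalizing a with
  | zero =>
    have h := finiteContFract_mem_Icc 1 a ha
    rw [Real.dist_eq, finiteContFract, zero_sub, abs_neg, abs_of_nonneg h.1]
    linarith [h.2]
  | succ n ih =>
    have h1 := finiteContFract_mem_Icc n (fun i => a (i + 1)) fun i => ha (i + 1)
    have h2 := finiteContFract_mem_Icc (n + 1) (fun i => a (i + 1)) fun i => ha (i + 1)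
    have h3 := ih (fun i => a (i + 1)) fun i => ha (i + 1)
    rw [finiteContFract, finiteContFract.eq_def (n + 1 + 1)]
    dsimp only
    set u := finiteContFract n fun i => a (i + 1)
    set w := finiteContFract (n + 1) fun i => a (i + 1)
    have h4 : (2 : ℝ) ≤ a 0 := by exact_mod_cast ha 0
    have hu : 2 ≤ a 0 + u := by linarith [h1.1]
    have hw : 2 ≤ a 0 + w := by linarith [h2.1]
    have h5 : 1 / (a 0 + u) - 1 / (a 0 + w) = (w - u) / ((a 0 + u) * (a 0 + w)) := by
      field_simp
      ring
    rw [Real.dist_eq, h5, abs_div, abs_of_pos (by positivity : 0 < (a 0 + u) * (a 0 + w)),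
      div_le_iff₀ (by positivity), abs_sub_comm]
    rw [Real.dist_eq] at h3
    have h6 : (2 : ℝ) ≤ (a 0 + u) * (a 0 + w) := by nlinarith
    have h7 : (0 : ℝ) ≤ (1 / 2) ^ n := by positivity
    rw [pow_succ]
    nlinarith

theorem exists_contFract_value : ∃ V : (ℕ → ℕ) → ℝ, ∀ a : ℕ → ℕ, (∀ i, 2 ≤ a i) →
    V a ∈ Set.Icc (0 : ℝ) (1 / 2) ∧ V a = 1 / (a 0 + V fun i => a (i + 1)) := by
  have hlim : ∀ a : ℕ → ℕ, ∃ v, (∀ i, 2 ≤ a i) →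
      Tendsto (fun n => finiteContFract n a) atTop (𝓝 v) := by
    intro a
    by_cases ha : ∀ i, 2 ≤ a i
    · obtain ⟨v, hv⟩ := cauchySeq_tendsto_of_complete (cauchySeq_of_le_geometric (1 / 2) 1
        (by norm_num) fun n => dist_finiteContFract_le n a ha)
      exact ⟨v, fun _ => hv⟩
    · exact ⟨0, fun h => absurd h ha⟩
  choose V hV using hlim
  have hmem : ∀ a : ℕ → ℕ, (∀ i, 2 ≤ a i) → V a ∈ Set.Icc (0 : ℝ) (1 / 2) := fun a ha =>
    isClosed_Icc.mem_of_tendsto (hV a ha) (Eventually.of_forall fun n =>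
      finiteContFract_mem_Icc n a ha)
  refine ⟨V, fun a ha => ⟨hmem a ha, ?_⟩⟩
  have h1 := (hV a ha).comp (tendsto_add_atTop_nat 1)
  have h2 := hV (fun i => a (i + 1)) fun i => ha (i + 1)
  have h4 : (2 : ℝ) ≤ a 0 := by exact_mod_cast ha 0
  have h3 := (hmem (fun i => a (i + 1)) fun i => ha (i + 1)).1
  refine tendsto_nhds_unique h1 ?_
  exact tendsto_const_nhds.div (h2.const_add (a 0 : ℝ)) (by linarith)

/-- Every sequence of integers `≥ 2` is the sequence of partial quotients of some number. -/
theorem exists_partialQuotient_eq (a : ℕ → ℕ) (ha : ∀ i, 2 ≤ a i) :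
    ∃ x : ℝ, (∀ n, gaussMap^[n] x ∈ Set.Ioc (0 : ℝ) (1 / 2)) ∧
      ∀ n, partialQuotient (n + 1) x = a n := by
  obtain ⟨V, hV⟩ := exists_contFract_value
  have hpos : ∀ a : ℕ → ℕ, (∀ i, 2 ≤ a i) → V a ∈ Set.Ioc (0 : ℝ) (1 / 2) := fun a ha => by
    refine ⟨?_, (hV a ha).1.2⟩
    rw [(hV a ha).2]
    have h1 := (hV (fun i => a (i + 1)) fun i => ha (i + 1)).1.1
    have h4 : (2 : ℝ) ≤ a 0 := by exact_mod_cast ha 0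
    positivity
  have hfloor : ∀ a : ℕ → ℕ, (∀ i, 2 ≤ a i) → ⌊1 / V a⌋ = (a 0 : ℤ) := fun a ha => by
    have h1 := hpos (fun i => a (i + 1)) fun i => ha (i + 1)
    rw [(hV a ha).2, one_div_one_div, Int.floor_eq_iff]
    push_cast
    constructor <;> linarith [h1.1, h1.2]
  have hgauss : ∀ a : ℕ → ℕ, (∀ i, 2 ≤ a i) → gaussMap (V a) = V fun i => a (i + 1) :=
    fun a ha => by
    rw [gaussMap, hfloor a ha, (hV a ha).2, one_div_one_div]
    push_cast
    ring
  have hiter : ∀ n, gaussMap^[n] (V a) = V fun i => a (i + n) := by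
    intro n
    induction n with
    | zero => rfl
    | succ n ih =>
      rw [Function.iterate_succ_apply', ih, hgauss _ fun i => ha _]
      congr 1
      funext i
      congr 1
      omega
  refine ⟨V a, fun n => ?_, fun n => ?_⟩
  · rw [hiter]; exact hpos _ fun i => ha _
  · rw [partialQuotient_succ, hiter, hfloor _ fun i => ha _, zero_add]

/-! ### Asymptotics of the exponents -/

/-- Linear errors in `log a_n` sum to quadratic ones, so the exponents in both dimension bounds take
this form; only the sign of `κ` has to be checked. -/
theorem tendsto_quadratic_sub_exponential {α κ : ℝ} (hα : 1 < α) (hκ : 0 < κ) (A B C : ℝ) :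
    Tendsto (fun n : ℕ => A + B * n + C * (n : ℝ) ^ 2 - κ * α ^ n) atTop atBot := by
  have hpow : Tendsto (fun n : ℕ => α ^ n) atTop atTop := tendsto_pow_atTop_atTop_of_one_lt hα
  have h (k : ℕ) := tendsto_pow_const_div_const_pow_of_one_lt k hα
  have h1 : Tendsto (fun n : ℕ => A * ((n : ℝ) ^ 0 / α ^ n) + B * ((n : ℝ) ^ 1 / α ^ n) +
      C * ((n : ℝ) ^ 2 / α ^ n) - κ) atTop (𝓝 (A * 0 + B * 0 + C * 0 - κ)) :=
    ((((h 0).const_mul A).add ((h 1).const_mul B)).add ((h 2).const_mul C)).sub_const κ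
  refine (hpow.atTop_mul_neg (by simpa using hκ) h1).congr fun n => ?_
  have : α ^ n ≠ 0 := by positivity
  field_simp

theorem sum_range_pow_succ {α : ℝ} (hα : 1 < α) (n : ℕ) :
    ∑ i ∈ Finset.range n, α ^ (i + 1) = (α * α ^ n - α) / (α - 1) := by
  have : α - 1 ≠ 0 := by linarith
  simp_rw [pow_succ, ← Finset.sum_mul, geom_sum_eq hα.ne']
  field_simp

theorem sum_range_cast_succ (n : ℕ) :
    ∑ i ∈ Finset.range n, ((i : ℝ) + 1) = n * (n + 1) / 2 := by
  induction n with
  | zero => simp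
  | succ n ih => rw [Finset.sum_range_succ, ih]; push_cast; ring

theorem tendsto_succ_mul_exp_sub {α : ℝ} (hα : 1 < α) :
    Tendsto (fun n : ℕ => ((n : ℝ) + 1) * (Real.exp (α ^ n) / Real.exp (α ^ (n + 1))))
      atTop (𝓝 0) := by
  have h := tendsto_quadratic_sub_exponential hα (sub_pos.2 hα) 0 1 0
  refine squeeze_zero (fun n => by positivity) (fun n => ?_) (Real.tendsto_exp_atBot.comp h)
  have h1 : (n : ℝ) + 1 ≤ Real.exp n := Real.add_one_le_exp _
  rw [← Real.exp_sub, Function.comp_apply]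
  refine (mul_le_mul_of_nonneg_right h1 (Real.exp_pos _).le).trans_eq ?_
  rw [← Real.exp_add]
  congr 1
  ring

theorem tendsto_exp_pow_div_exp_pow_succ {α : ℝ} (hα : 1 < α) :
    Tendsto (fun n : ℕ => Real.exp (α ^ n) / Real.exp (α ^ (n + 1))) atTop (𝓝 0) := by
  refine squeeze_zero (fun n => by positivity) (fun n => ?_) (tendsto_succ_mul_exp_sub hα)
  exact le_mul_of_one_le_left (by positivity) (by linarith [Nat.cast_nonneg (α := ℝ) n])

/-! ### From the sum to the size of each partial quotient -/

theorem productSum_succ (n : ℕ) (x : ℝ) : productSum (n + 1) x =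
    productSum n x + partialQuotient (n + 1) x * partialQuotient (n + 2) x := by
  rw [productSum, Finset.sum_Icc_succ_top (by omega)]
  rfl

/-- The normalised sum is the normalised last product plus the previous normalised sum times a ratio
tending to zero. For the converse the crude bound `K * (n + 1)` on the sums suffices, as the ratio
also beats linear factors. -/
theorem tendsto_productSum_div_iff {α : ℝ} (hα : 1 < α) {x : ℝ} :
    Tendsto (fun n : ℕ => (productSum n x : ℝ) / Real.exp (α ^ n)) atTop (𝓝 1) ↔
    Tendsto (fun n : ℕ => (partialQuotient (n + 1) x * partialQuotient (n + 2) x : ℝ) /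
      Real.exp (α ^ (n + 1))) atTop (𝓝 1) := by
  have hstep : ∀ n : ℕ, (productSum (n + 1) x : ℝ) / Real.exp (α ^ (n + 1)) =
      (partialQuotient (n + 1) x * partialQuotient (n + 2) x : ℝ) / Real.exp (α ^ (n + 1)) +
      (productSum n x : ℝ) / Real.exp (α ^ n) *
        (Real.exp (α ^ n) / Real.exp (α ^ (n + 1))) := fun n => by
    rw [productSum_succ]
    push_cast
    field_simp
    ring
  constructor
  · intro h
    have h1 := ((tendsto_add_atTop_iff_nat 1).2 h).sub
      (h.mul (tendsto_exp_pow_div_exp_pow_succ hα))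
    rw [mul_zero, sub_zero] at h1
    refine h1.congr fun n => ?_
    rw [hstep, add_sub_cancel_right]
  · intro h
    obtain ⟨K, hK⟩ := h.norm.bddAbove_range
    have hK0 : 0 ≤ K := (norm_nonneg _).trans (hK ⟨0, rfl⟩)
    have hbound : ∀ n : ℕ, |(productSum n x : ℝ) / Real.exp (α ^ n)| ≤ K * (n + 1) := by
      intro n
      induction n with
      | zero => simpa [productSum] using hK0
      | succ n ih =>
        rw [hstep]
        have h1 := hK ⟨n, rfl⟩
        have h2 : Real.exp (α ^ n) / Real.exp (α ^ (n + 1)) ≤ 1 := by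
          rw [div_le_one (Real.exp_pos _)]
          exact Real.exp_le_exp.2 (pow_le_pow_right₀ hα.le (by omega))
        have h3 : 0 < Real.exp (α ^ n) / Real.exp (α ^ (n + 1)) := by positivity
        refine (abs_add_le _ _).trans ?_
        rw [abs_mul, abs_of_pos h3]
        have h4 := mul_le_mul ih h2 h3.le (by positivity)
        dsimp only at h1
        rw [Real.norm_eq_abs] at h1
        push_cast
        linarith
    rw [← tendsto_add_atTop_iff_nat 1]
    have h1 : Tendsto (fun n : ℕ => (productSum n x : ℝ) / Real.exp (α ^ n) *
        (Real.exp (α ^ n) / Real.exp (α ^ (n + 1)))) atTop (𝓝 0) := by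
      have h2 := (tendsto_succ_mul_exp_sub hα).const_mul K
      rw [mul_zero] at h2
      refine squeeze_zero_norm (fun n => ?_) h2
      rw [norm_mul, Real.norm_eq_abs, Real.norm_eq_abs,
        abs_of_pos (by positivity : 0 < Real.exp (α ^ n) / Real.exp (α ^ (n + 1))), ← mul_assoc]
      exact mul_le_mul_of_nonneg_right (hbound n) (by positivity)
    have h2 := h.add h1
    rw [add_zero] at h2
    exact h2.congr fun n => (hstep n).symm

/-- The irrationals of `(0, 1)` whose `(n + 1)`-st partial quotient differs from
`exp (c * α ^ (n + 1))` by a factor of at most `exp (K * (n + 1))`, for every `n`. -/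
def logBandSet (α c K : ℝ) : Set ℝ :=
  {x | x ∈ Set.Ioo (0 : ℝ) 1 ∧ Irrational x ∧
    ∀ n : ℕ, Real.exp (c * α ^ (n + 1) - K * (n + 1)) ≤ partialQuotient (n + 1) x ∧
      partialQuotient (n + 1) x ≤ Real.exp (c * α ^ (n + 1) + K * (n + 1))}

theorem growthSet_subset_iUnion_logBandSet {α : ℝ} (hα : 1 < α) :
    growthSet (fun n : ℕ => Real.exp (α ^ n)) ⊆ ⋃ K : ℕ, logBandSet α (1 / (1 + α)) K := by
  rintro x ⟨h01, hx, hlim⟩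
  rw [tendsto_productSum_div_iff hα] at hlim
  set d : ℕ → ℝ := fun n => partialQuotient (n + 1) x with hd
  have hd1 : ∀ n, 1 ≤ d n := fun n => by
    simp only [hd]
    exact_mod_cast one_le_partialQuotient_succ (iterate_gaussMap_mem_Ioo hx h01) n
  have hd0 : ∀ n, 0 < d n := fun n => zero_lt_one.trans_le (hd1 n)
  obtain ⟨B, hB⟩ := (hlim.log one_ne_zero).norm.bddAbove_range
  have hα1 : 1 + α ≠ 0 := by linarith
  have hbound : ∀ n, |Real.log (d n) + Real.log (d (n + 1)) - α ^ (n + 1)| ≤ B := fun n => by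
    have h1 := hB ⟨n, rfl⟩
    dsimp only at h1
    rw [Real.norm_eq_abs, Real.log_div (mul_pos (hd0 n) (hd0 (n + 1))).ne' (Real.exp_pos _).ne',
      Real.log_exp] at h1
    rwa [← Real.log_mul (hd0 n).ne' (hd0 (n + 1)).ne']
  -- `K` dominates both the initial deviation and the increment at each step.
  obtain ⟨K, hK⟩ := exists_nat_ge (max B |Real.log (d 0) - 1 / (1 + α) * α ^ (0 + 1)|)
  have hKB := (le_max_left _ _).trans hK
  have hK0 := (le_max_right _ _).trans hK
  have hlog : ∀ n : ℕ, |Real.log (d n) - 1 / (1 + α) * α ^ (n + 1)| ≤ K * (n + 1) := by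
    intro n
    induction n with
    | zero => simpa using hK0
    | succ n ih =>
      -- The deviation from the exact solution `α ^ (n + 1) / (1 + α)` changes sign at each step, up
      -- to a bounded term, so its size grows at most linearly.
      have h1 : Real.log (d (n + 1)) - 1 / (1 + α) * α ^ (n + 1 + 1) =
          (Real.log (d n) + Real.log (d (n + 1)) - α ^ (n + 1)) -
          (Real.log (d n) - 1 / (1 + α) * α ^ (n + 1)) := by
        field_simp
        ring
      rw [h1]
      refine (abs_sub _ _).trans ?_
      push_cast
      linarith [hbound n]
  refine Set.mem_iUnion.2 ⟨K, h01, hx, fun n => ?_⟩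
  have h1 := abs_le.1 (hlog n)
  change _ ≤ d n ∧ d n ≤ _
  rw [← Real.le_log_iff_exp_le (hd0 n), ← Real.log_le_iff_le_exp (hd0 n)]
  constructor <;> linarith [h1.1, h1.2]

/-! ### Upper bound: covering by cylinders -/

open MeasureTheory in
theorem dimH_logBandSet_le {α c K : ℝ} (hα : 1 < α) (hc : 0 < c) (hK : 0 ≤ K) {s : NNReal}
    (hs : 1 / (1 + α) < s) : dimH (logBandSet α c K) ≤ s := by
  have hs0 : (0 : ℝ) < s := lt_trans (by positivity) hs
  let u : ℕ → ℝ := fun i => c * α ^ (i + 1) + K * (i + 1)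
  let l : ℕ → ℝ := fun i => c * α ^ (i + 1) - K * (i + 1)
  let N : ℕ → ℕ := fun i => ⌊Real.exp (u i)⌋₊
  let D : ℕ → ℝ := fun n => -l n + -2 * ∑ i ∈ Finset.range n, l i
  have hu0 : ∀ i, 0 ≤ u i := fun i => by positivity
  have hsl : ∀ n, ∑ i ∈ Finset.range n, l i =
      c * ((α * α ^ n - α) / (α - 1)) - K * (n * (n + 1) / 2) := fun n => by
    simp only [l]
    rw [Finset.sum_sub_distrib, ← Finset.mul_sum, ← Finset.mul_sum, sum_range_pow_succ hα,
      sum_range_cast_succ]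
  have hsu : ∀ n, ∑ i ∈ Finset.range n, u i =
      c * ((α * α ^ n - α) / (α - 1)) + K * (n * (n + 1) / 2) := fun n => by
    simp only [u]
    rw [Finset.sum_add_distrib, ← Finset.mul_sum, ← Finset.mul_sum, sum_range_pow_succ hα,
      sum_range_cast_succ]
  have hα0 : 0 < α - 1 := sub_pos.2 hα
  have hα0' : α - 1 ≠ 0 := hα0.ne'
  have hD : Tendsto D atTop atBot := by
    have hκ : 0 < c * α + 2 * c * α / (α - 1) := by positivity
    refine (tendsto_quadratic_sub_exponential hα hκ (K + 2 * c * α / (α - 1)) (2 * K) K).congr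
      fun n => ?_
    simp only [D]
    rw [hsl]
    simp only [l]
    field_simp
    ring
  -- The logarithm of the number of pieces plus `s` times that of their diameter; `s > 1 / (1 + α)`
  -- is exactly what makes `κ` positive.
  have hT : Tendsto (fun n : ℕ => (∑ i ∈ Finset.range n, (u i + 1)) + s * D n) atTop atBot := by
    have hκ : 0 < c * α * (s * (1 + α) - 1) / (α - 1) := by
      rw [div_lt_iff₀ (by linarith)] at hs
      have : 0 < s * (1 + α) - 1 := by linarith
      positivity
    refine (tendsto_quadratic_sub_exponential hα hκ
      (s * K + (2 * s - 1) * c * α / (α - 1)) (K / 2 + 1 + 2 * s * K) (K / 2 + s * K)).congr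
      fun n => ?_
    simp only [D]
    rw [Finset.sum_add_distrib, hsl, hsu, Finset.sum_const, Finset.card_range, nsmul_one]
    simp only [l]
    field_simp
    ring
  let ι : ℕ → Type := fun n => (i : Fin n) → Fin (N i + 1)
  let t : (n : ℕ) → ι n → Set ℝ := fun n w =>
    {x | x ∈ logBandSet α c K ∧ ∀ i : Fin n, partialQuotient (i + 1) x = (w i : ℕ)}
  have hdiam : ∀ n w, Metric.ediam (t n w) ≤ ENNReal.ofReal (Real.exp (D n)) := by
    intro n w
    refine Metric.ediam_le fun x hx y hy => ?_
    rw [edist_dist]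
    refine ENNReal.ofReal_le_ofReal ?_
    have hx' := iterate_gaussMap_mem_Ioo hx.1.2.1 hx.1.1
    have hy' := iterate_gaussMap_mem_Ioo hy.1.2.1 hy.1.1
    rw [Real.dist_eq]
    refine (abs_sub_le_of_partialQuotient_eq (l := l) hx' hy' n
      (fun i hi => (hx.2 ⟨i, hi⟩).trans (hy.2 ⟨i, hi⟩).symm)
      (fun i _ => (hx.1.2.2 i).1)).trans ?_
    simp only [D]
    rw [Real.exp_add]
    refine mul_le_mul_of_nonneg_right ?_ (Real.exp_pos _).le
    -- The next quotient is also large, which confines the `n`-th iterate near zero; this gain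
    -- separates `1 / (1 + α)` from `1 / 2`.
    have key : ∀ z ∈ logBandSet α c K, gaussMap^[n] z ∈ Set.Icc 0 (Real.exp (-l n)) := by
      intro z hz
      have h1 := iterate_gaussMap_mem_Ioo hz.2.1 hz.1 n
      refine ⟨h1.1.le, (le_one_div_floor h1).trans ?_⟩
      rw [Real.exp_neg, ← one_div]
      exact one_div_le_one_div_of_le (Real.exp_pos _) (hz.2.2 n).1
    have h1 := key x hx.1
    have h2 := key y hy.1
    rw [abs_le]
    constructor <;> linarith [h1.1, h1.2, h2.1, h2.2]
  have hcover : ∀ n, logBandSet α c K ⊆ ⋃ w, t n w := by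
    intro n x hx
    have h1 := one_le_partialQuotient_succ (iterate_gaussMap_mem_Ioo hx.2.1 hx.1)
    have h2 : ∀ i : ℕ, (partialQuotient (i + 1) x).toNat < N i + 1 := fun i => by
      rw [Nat.lt_succ_iff]
      refine Nat.le_floor ?_
      have h3 : (((partialQuotient (i + 1) x).toNat : ℤ) : ℝ) = partialQuotient (i + 1) x := by
        rw [Int.toNat_of_nonneg (by linarith [h1 i])]
      rw [Int.cast_natCast] at h3
      rw [h3]
      exact (hx.2.2 i).2
    refine Set.mem_iUnion.2 ⟨fun i => ⟨_, h2 i⟩, hx, fun i => ?_⟩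
    exact (Int.toNat_of_nonneg (by linarith [h1 i])).symm
  have hr : Tendsto (fun n => ENNReal.ofReal (Real.exp (D n))) atTop (𝓝 0) := by
    have := ENNReal.tendsto_ofReal (Real.tendsto_exp_atBot.comp hD)
    rwa [ENNReal.ofReal_zero] at this
  have hcard : ∀ n, (Fintype.card (ι n) : ℝ) ≤
      Real.exp (∑ i ∈ Finset.range n, (u i + 1)) := by
    intro n
    simp only [ι]
    rw [Fintype.card_pi, Real.exp_sum, ← Fin.prod_univ_eq_prod_range (fun i => Real.exp (u i + 1))]
    push_cast
    refine Finset.prod_le_prod (fun i _ => by positivity) fun i _ => ?_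
    rw [Fintype.card_fin]
    push_cast
    have h1 : (N i : ℝ) ≤ Real.exp (u i) := Nat.floor_le (Real.exp_pos _).le
    have h2 : (1 : ℝ) ≤ Real.exp (u i) := Real.one_le_exp (hu0 i)
    have h3 : (2 : ℝ) ≤ Real.exp 1 := by linarith [Real.add_one_le_exp (1 : ℝ)]
    rw [Real.exp_add]
    nlinarith
  have hmeas : Measure.hausdorffMeasure (s : ℝ) (logBandSet α c K) ≤ 0 := by
    refine (Measure.hausdorffMeasure_le_liminf_sum (s : ℝ) _ _ hr t (Eventually.of_forall hdiam)
      (Eventually.of_forall hcover)).trans ?_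
    have hlim : Tendsto (fun n => ∑ w, Metric.ediam (t n w) ^ (s : ℝ)) atTop (𝓝 0) := by
      have h0 := ENNReal.tendsto_ofReal (Real.tendsto_exp_atBot.comp hT)
      rw [ENNReal.ofReal_zero] at h0
      refine tendsto_of_tendsto_of_tendsto_of_le_of_le tendsto_const_nhds h0
        (fun n => zero_le) fun n => ?_
      calc ∑ w, Metric.ediam (t n w) ^ (s : ℝ)
          ≤ ∑ w : ι n, ENNReal.ofReal (Real.exp (s * D n)) := by
            refine Finset.sum_le_sum fun w _ => ?_
            refine (ENNReal.rpow_le_rpow (hdiam n w) hs0.le).trans_eq ?_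
            rw [ENNReal.ofReal_rpow_of_pos (Real.exp_pos _), ← Real.exp_mul, mul_comm]
        _ = ENNReal.ofReal (Fintype.card (ι n) * Real.exp (s * D n)) := by
            rw [Finset.sum_const, nsmul_eq_mul, ENNReal.ofReal_mul (Nat.cast_nonneg _),
              ENNReal.ofReal_natCast, Finset.card_univ]
        _ ≤ _ := by
            refine ENNReal.ofReal_le_ofReal ?_
            rw [Function.comp_apply, Real.exp_add]
            exact mul_le_mul_of_nonneg_right (hcard n) (Real.exp_pos _).le
    exact hlim.liminf_eq.le
  refine dimH_le_of_hausdorffMeasure_ne_top ?_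
  rw [nonpos_iff_eq_zero.1 hmeas]
  exact ENNReal.zero_ne_top

theorem dimH_growthSet_le {α : ℝ} (hα : 1 < α) :
    dimH (growthSet (fun n : ℕ => Real.exp (α ^ n))) ≤ ENNReal.ofReal (1 / (1 + α)) := by
  by_contra! h
  obtain ⟨s, hs1, hs2⟩ := ENNReal.lt_iff_exists_nnreal_btwn.1 h
  have hs : 1 / (1 + α) < s := by
    rw [← ENNReal.ofReal_coe_nnreal] at hs1
    exact lt_of_not_ge fun h => absurd (ENNReal.ofReal_le_ofReal h) hs1.not_ge
  refine absurd ((dimH_mono (growthSet_subset_iUnion_logBandSet hα)).trans ?_) hs2.not_ge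
  rw [dimH_iUnion]
  exact iSup_le fun K => dimH_logBandSet_le hα (by positivity) (Nat.cast_nonneg K) hs

/-! ### Lower bound: Hölder inverses and mixed radix digits -/

/-- The hypothesis makes `h` injective on `s` with Hölder inverse, and a Hölder map of exponent `r`
raises dimension by at most the factor `1 / r`. -/
theorem dimH_le_dimH_image_div {X Y : Type*} [MetricSpace X] [MetricSpace Y] [Nonempty X]
    {h : X → Y} {s : Set X} {C r : NNReal} (hr : 0 < r)
    (H : ∀ x ∈ s, ∀ y ∈ s, dist x y ≤ C * dist (h x) (h y) ^ (r : ℝ)) :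
    dimH s ≤ dimH (h '' s) / r := by
  have hr' : (0 : ℝ) < r := hr
  have hinj : Set.InjOn h s := fun x hx y hy hxy => by
    have h1 := H x hx y hy
    rw [hxy, dist_self, Real.zero_rpow hr'.ne', mul_zero] at h1
    exact dist_le_zero.1 h1
  have hholder : HolderOnWith C r (Function.invFunOn h s) (h '' s) := by
    rintro _ ⟨x, hx, rfl⟩ _ ⟨y, hy, rfl⟩
    rw [hinj.leftInvOn_invFunOn hx, hinj.leftInvOn_invFunOn hy, edist_dist, edist_dist,
      ENNReal.ofReal_rpow_of_nonneg dist_nonneg hr'.le, ← ENNReal.ofReal_coe_nnreal,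
      ← ENNReal.ofReal_mul C.coe_nonneg]
    exact ENNReal.ofReal_le_ofReal (H x hx y hy)
  have h1 := hholder.dimH_image_le hr
  rwa [hinj.invFunOn_image subset_rfl] at h1

/-- The remainders of the expansion of `y` in the mixed radix system with bases `m 0, m 1, …`. -/
noncomputable def radixRemainder (m : ℕ → ℕ) (y : ℝ) : ℕ → ℝ
  | 0 => y
  | n + 1 => Int.fract (m n * radixRemainder m y n)

/-- The digits of the expansion of `y` in the mixed radix system with bases `m 0, m 1, …`. -/
noncomputable def radixDigit (m : ℕ → ℕ) (y : ℝ) (n : ℕ) : ℕ := ⌊m n * radixRemainder m y n⌋₊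

theorem radixRemainder_mem_Ico (m : ℕ → ℕ) {y : ℝ} (hy : y ∈ Set.Ico (0 : ℝ) 1) (n : ℕ) :
    radixRemainder m y n ∈ Set.Ico (0 : ℝ) 1 := by
  cases n with
  | zero => exact hy
  | succ n => exact ⟨Int.fract_nonneg _, Int.fract_lt_one _⟩

theorem radixDigit_lt {m : ℕ → ℕ} {y : ℝ} (hy : y ∈ Set.Ico (0 : ℝ) 1) {n : ℕ} (hm : 0 < m n) :
    radixDigit m y n < m n := by
  have h1 := radixRemainder_mem_Ico m hy n
  have h2 : (0 : ℝ) < m n := by exact_mod_cast hm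
  rw [radixDigit, Nat.floor_lt (mul_nonneg h2.le h1.1)]
  nlinarith [h1.2]

theorem mul_radixRemainder {m : ℕ → ℕ} {y : ℝ} (hy : y ∈ Set.Ico (0 : ℝ) 1) (n : ℕ) :
    m n * radixRemainder m y n = radixDigit m y n + radixRemainder m y (n + 1) := by
  have h1 := radixRemainder_mem_Ico m hy n
  have h2 : 0 ≤ (m n : ℝ) * radixRemainder m y n := mul_nonneg (Nat.cast_nonneg _) h1.1
  rw [radixDigit, radixRemainder, natCast_floor_eq_intCast_floor h2, Int.floor_add_fract]

theorem prod_mul_abs_sub_eq {m : ℕ → ℕ} {y z : ℝ} (hy : y ∈ Set.Ico (0 : ℝ) 1)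
    (hz : z ∈ Set.Ico (0 : ℝ) 1) (n : ℕ) (h : ∀ i < n, radixDigit m y i = radixDigit m z i) :
    (∏ i ∈ Finset.range n, (m i : ℝ)) * |y - z| =
      |radixRemainder m y n - radixRemainder m z n| := by
  induction n with
  | zero => simp [radixRemainder]
  | succ n ih =>
    have h1 := mul_radixRemainder (m := m) hy n
    have h2 := mul_radixRemainder (m := m) hz n
    rw [h n (by omega)] at h1
    rw [Finset.prod_range_succ, mul_right_comm, ih fun i hi => h i (by omega), mul_comm,
      ← Nat.abs_cast (m n), ← abs_mul]
    congr 1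
    linarith

theorem exists_radixDigit_ne {m : ℕ → ℕ} (hm : ∀ n, 2 ≤ m n) {y z : ℝ}
    (hy : y ∈ Set.Ico (0 : ℝ) 1) (hz : z ∈ Set.Ico (0 : ℝ) 1) (hyz : y ≠ z) :
    ∃ n, radixDigit m y n ≠ radixDigit m z n := by
  by_contra! h
  have hpos : 0 < |y - z| := abs_pos.2 (sub_ne_zero.2 hyz)
  obtain ⟨n, hn⟩ := pow_unbounded_of_one_lt (1 / |y - z|) (one_lt_two (α := ℝ))
  have h1 := prod_mul_abs_sub_eq hy hz n fun i _ => h i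
  have h2 := radixRemainder_mem_Ico m hy n
  have h3 := radixRemainder_mem_Ico m hz n
  have h4 : |radixRemainder m y n - radixRemainder m z n| ≤ 1 :=
    abs_le.2 ⟨by linarith [h2.1, h3.2], by linarith [h2.2, h3.1]⟩
  have h5 : (2 : ℝ) ^ n ≤ ∏ i ∈ Finset.range n, (m i : ℝ) := by
    rw [← Finset.card_range n, ← Finset.prod_const, Finset.card_range]
    exact Finset.prod_le_prod (fun _ _ => by norm_num) fun i _ => by exact_mod_cast hm i
  rw [div_lt_iff₀ hpos] at hn
  nlinarith

theorem one_le_abs_natCast_sub {a b : ℕ} (h : a ≠ b) : (1 : ℝ) ≤ |(a : ℝ) - b| := by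
  have : (1 : ℤ) ≤ |(a : ℤ) - b| := Int.one_le_abs (sub_ne_zero.2 (by exact_mod_cast h))
  exact_mod_cast this

/-- If `y` and `z` first differ at the `n`-th digit, their distance is controlled by the
difference of these digits. -/
theorem prod_mul_abs_sub_le {m : ℕ → ℕ} {y z : ℝ} (hy : y ∈ Set.Ico (0 : ℝ) 1)
    (hz : z ∈ Set.Ico (0 : ℝ) 1) (n : ℕ) (h : ∀ i < n, radixDigit m y i = radixDigit m z i)
    (hn : radixDigit m y n ≠ radixDigit m z n) :
    (∏ i ∈ Finset.range (n + 1), (m i : ℝ)) * |y - z| ≤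
      2 * |(radixDigit m y n : ℝ) - radixDigit m z n| := by
  have h2 := radixRemainder_mem_Ico m hy (n + 1)
  have h3 := radixRemainder_mem_Ico m hz (n + 1)
  have h4 : |radixRemainder m y (n + 1) - radixRemainder m z (n + 1)| ≤ 1 :=
    abs_le.2 ⟨by linarith [h2.1, h3.2], by linarith [h2.2, h3.1]⟩
  have h5 := one_le_abs_natCast_sub hn
  rw [Finset.prod_range_succ, mul_right_comm, prod_mul_abs_sub_eq hy hz n h, mul_comm,
    ← Nat.abs_cast (m n), ← abs_mul, mul_sub, mul_radixRemainder hy, mul_radixRemainder hz]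
  rw [add_sub_add_comm]
  exact (abs_add_le _ _).trans (by linarith)

/-- If the first partial quotients differ and the Gauss map sends both points below `1 / 2`, the
distance of the points is bounded below by the difference of these quotients. -/
theorem abs_floor_sub_mul_le {x y : ℝ} {u : ℝ} (hx : x ∈ Set.Ioo (0 : ℝ) 1)
    (hy : y ∈ Set.Ioo (0 : ℝ) 1) (hTx : gaussMap x ∈ Set.Ioc (0 : ℝ) (1 / 2))
    (hTy : gaussMap y ∈ Set.Ioc (0 : ℝ) (1 / 2))
    (hne : (1 : ℝ) ≤ |(⌊1 / x⌋ : ℝ) - ⌊1 / y⌋|)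
    (hxu : (⌊1 / x⌋ : ℝ) + 1 ≤ Real.exp u) (hyu : (⌊1 / y⌋ : ℝ) + 1 ≤ Real.exp u) :
    |(⌊1 / x⌋ : ℝ) - ⌊1 / y⌋| / 2 * Real.exp (-2 * u) ≤ |x - y| := by
  have key : ∀ z, z ∈ Set.Ioo (0 : ℝ) 1 → (⌊1 / z⌋ : ℝ) + 1 ≤ Real.exp u →
      Real.exp (-u) ≤ z := fun z hz hz' => by
    rw [Real.exp_neg, ← one_div]
    have h1 : (1 : ℝ) ≤ (⌊1 / z⌋ : ℝ) := by exact_mod_cast one_le_floor_one_div hz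
    exact (one_div_le_one_div_of_le (by linarith) hz').trans (one_div_floor_add_one_le hz)
  have h1 : (⌊1 / x⌋ : ℝ) - ⌊1 / y⌋ = (1 / x - 1 / y) - (gaussMap x - gaussMap y) := by
    unfold gaussMap; ring
  -- As the quotients differ by at least one, an error of `1 / 2` removes at most half of their
  -- difference.
  have h2 : |gaussMap x - gaussMap y| ≤ 1 / 2 :=
    abs_le.2 ⟨by linarith [hTx.1, hTy.2], by linarith [hTx.2, hTy.1]⟩
  have h3 : |(⌊1 / x⌋ : ℝ) - ⌊1 / y⌋| ≤ |1 / x - 1 / y| + |gaussMap x - gaussMap y| := by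
    rw [h1]; exact abs_sub _ _
  have h4 : |x - y| = |1 / x - 1 / y| * (x * y) := by
    have hx0 := hx.1.ne'
    have hy0 := hy.1.ne'
    rw [← abs_of_pos (mul_pos hx.1 hy.1), ← abs_mul, abs_sub_comm]
    congr 1
    field_simp
  rw [h4]
  refine mul_le_mul (by linarith) ?_ (Real.exp_pos _).le (abs_nonneg _)
  calc Real.exp (-2 * u) = Real.exp (-u) * Real.exp (-u) := by rw [← Real.exp_add]; ring_nf
    _ ≤ x * y := mul_le_mul (key x hx hxu) (key y hy hyu) (Real.exp_pos _).le hx.1.le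

/-! ### Lower bound: coding digits into partial quotients -/

section
variable (α : ℝ)

/-- The typical size `exp (α ^ n / (1 + α))` of the `n`-th partial quotient, indexed from `0`. -/
noncomputable def quotientScale (n : ℕ) : ℝ := Real.exp (1 / (1 + α) * α ^ (n + 1))

/-- The number of choices of the partial quotient of index `n`. -/
noncomputable def choiceCount (n : ℕ) : ℕ := ⌊quotientScale α n / (n + 1)⌋₊ + 2

/-- The partial quotient of index `n` that encodes the `n`-th digit of `y`. -/
noncomputable def codedQuotient (y : ℝ) (n : ℕ) : ℕ :=
  ⌈quotientScale α n⌉₊ + radixDigit (choiceCount α) y n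

end

section
variable {α : ℝ}

theorem one_lt_quotientScale (hα : 1 < α) (n : ℕ) : 1 < quotientScale α n :=
  Real.one_lt_exp_iff.2 (by positivity)

theorem two_le_codedQuotient (hα : 1 < α) (y : ℝ) (n : ℕ) : 2 ≤ codedQuotient α y n := by
  have : 1 < ⌈quotientScale α n⌉₊ := Nat.lt_ceil.2 (by exact_mod_cast one_lt_quotientScale hα n)
  unfold codedQuotient
  omega

theorem quotientScale_le_codedQuotient (y : ℝ) (n : ℕ) :
    quotientScale α n ≤ codedQuotient α y n := by
  unfold codedQuotient
  push_cast
  linarith [Nat.le_ceil (quotientScale α n),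
    Nat.cast_nonneg (α := ℝ) (radixDigit (choiceCount α) y n)]

theorem choiceCount_le (hα : 1 < α) (n : ℕ) :
    (choiceCount α n : ℝ) ≤ quotientScale α n / (n + 1) + 2 := by
  have h1 := one_lt_quotientScale hα n
  unfold choiceCount
  push_cast
  linarith [Nat.floor_le (by positivity : 0 ≤ quotientScale α n / ((n : ℝ) + 1))]

theorem quotientScale_div_le (hα : 1 < α) (n : ℕ) : quotientScale α n / (n + 1) ≤
    quotientScale α n :=
  div_le_self (by linarith [one_lt_quotientScale hα n]) (by linarith [Nat.cast_nonneg (α := ℝ) n])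

theorem codedQuotient_le (hα : 1 < α) {y : ℝ} (hy : y ∈ Set.Ico (0 : ℝ) 1) (n : ℕ) :
    (codedQuotient α y n : ℝ) ≤ quotientScale α n + quotientScale α n / (n + 1) + 2 := by
  have h1 := one_lt_quotientScale hα n
  have h2 : (radixDigit (choiceCount α) y n : ℝ) + 1 ≤ choiceCount α n := by
    exact_mod_cast radixDigit_lt hy (by unfold choiceCount; omega)
  have h3 := choiceCount_le hα n
  have h4 := Nat.ceil_lt_add_one (zero_le_one.trans h1.le)
  unfold codedQuotient
  push_cast
  linarith

theorem five_mul_quotientScale_le (n : ℕ) :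
    5 * quotientScale α n ≤ Real.exp (1 / (1 + α) * α ^ (n + 1) + 2) := by
  have h1 : (5 : ℝ) ≤ Real.exp 2 := by
    have h2 := Real.exp_one_gt_d9
    rw [show (2 : ℝ) = 1 + 1 by norm_num, Real.exp_add]
    nlinarith
  rw [Real.exp_add, mul_comm]
  exact mul_le_mul_of_nonneg_left h1 (Real.exp_pos _).le

theorem codedQuotient_add_one_le (hα : 1 < α) {y : ℝ} (hy : y ∈ Set.Ico (0 : ℝ) 1) (n : ℕ) :
    (codedQuotient α y n : ℝ) + 1 ≤ Real.exp (1 / (1 + α) * α ^ (n + 1) + 2) := by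
  linarith [codedQuotient_le hα hy n, quotientScale_div_le hα n, one_lt_quotientScale hα n,
    five_mul_quotientScale_le (α := α) n]

theorem choiceCount_le_exp (hα : 1 < α) (n : ℕ) :
    (choiceCount α n : ℝ) ≤ Real.exp (1 / (1 + α) * α ^ (n + 1) + 2) := by
  linarith [choiceCount_le hα n, quotientScale_div_le hα n, one_lt_quotientScale hα n,
    five_mul_quotientScale_le (α := α) n]

theorem exp_le_choiceCount (n : ℕ) :
    Real.exp (1 / (1 + α) * α ^ (n + 1) - (n + 1)) ≤ choiceCount α n := by
  have h1 : (n : ℝ) + 1 ≤ Real.exp (n + 1) := by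
    linarith [Real.add_one_le_exp ((n : ℝ) + 1)]
  have h2 := Nat.lt_floor_add_one (quotientScale α n / ((n : ℝ) + 1))
  rw [Real.exp_sub]
  refine (div_le_div_of_nonneg_left (Real.exp_pos _).le (by positivity) h1).trans ?_
  unfold choiceCount
  push_cast
  exact h2.le.trans (by linarith)

theorem tendsto_quotientScale (hα : 1 < α) : Tendsto (quotientScale α) atTop atTop := by
  refine Real.tendsto_exp_atTop.comp (Tendsto.const_mul_atTop (by positivity) ?_)
  exact (tendsto_pow_atTop_atTop_of_one_lt hα).comp (tendsto_add_atTop_nat 1)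

/-- The divisor `n + 1` in `choiceCount` makes the digit negligible against the scale, which the
limit one requires, at only a subexponential cost in the number of choices. -/
theorem tendsto_codedQuotient_div (hα : 1 < α) {y : ℝ} (hy : y ∈ Set.Ico (0 : ℝ) 1) :
    Tendsto (fun n => (codedQuotient α y n : ℝ) / quotientScale α n) atTop (𝓝 1) := by
  have h1 : Tendsto (fun n : ℕ => 1 + 1 / ((n : ℝ) + 1) + 2 / quotientScale α n) atTop
      (𝓝 (1 + 0 + 0)) :=
    (tendsto_one_div_add_atTop_nhds_zero_nat.const_add 1).add
      ((tendsto_quotientScale hα).const_div_atTop 2)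
  rw [add_zero, add_zero] at h1
  refine tendsto_of_tendsto_of_tendsto_of_le_of_le tendsto_const_nhds h1 (fun n => ?_) fun n => ?_
  · rw [le_div_iff₀ (zero_lt_one.trans (one_lt_quotientScale hα n)), one_mul]
    exact quotientScale_le_codedQuotient y n
  · have h0 := zero_lt_one.trans (one_lt_quotientScale hα n)
    dsimp only
    rw [div_le_iff₀ h0]
    refine (codedQuotient_le hα hy n).trans_eq ?_
    field_simp

theorem quotientScale_mul_succ (hα : 1 < α) (n : ℕ) :
    quotientScale α n * quotientScale α (n + 1) = Real.exp (α ^ (n + 1)) := by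
  have : 1 + α ≠ 0 := by linarith
  rw [quotientScale, quotientScale, ← Real.exp_add]
  congr 1
  field_simp
  ring

theorem mem_growthSet_of_partialQuotient_eq (hα : 1 < α) {x y : ℝ}
    (hy : y ∈ Set.Ico (0 : ℝ) 1) (hx : ∀ n, gaussMap^[n] x ∈ Set.Ioc (0 : ℝ) (1 / 2))
    (h : ∀ n, partialQuotient (n + 1) x = codedQuotient α y n) :
    x ∈ growthSet (fun n : ℕ => Real.exp (α ^ n)) := by
  have hx' : ∀ n, gaussMap^[n] x ∈ Set.Ioo (0 : ℝ) 1 := fun n =>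
    ⟨(hx n).1, (hx n).2.trans_lt (by norm_num)⟩
  refine ⟨hx' 0, irrational_of_iterate_gaussMap_mem_Ioo hx', ?_⟩
  rw [tendsto_productSum_div_iff hα]
  have h1 := tendsto_codedQuotient_div hα hy
  have h2 := h1.mul (h1.comp (tendsto_add_atTop_nat 1))
  rw [mul_one] at h2
  refine h2.congr fun n => ?_
  rw [Function.comp_apply, div_mul_div_comm, quotientScale_mul_succ hα, h n, h (n + 1)]
  push_cast
  rfl

/-- At the first differing digit, with difference `Δ`, both distances are proportional to `Δ` up to
controlled factors. Comparing `Δ` with `Δ ^ r` leaves `Δ ^ (1 - r)`, largest when `Δ` is of the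
order of the quotient itself; this extreme case determines the exponent. -/
theorem dist_le_of_partialQuotient_eq (hα : 1 < α) {r : ℝ} (hr0 : 0 < r)
    (hr : r < 1 / (1 + α)) : ∃ C : NNReal, ∀ x x' y y' : ℝ, y ∈ Set.Ico (0 : ℝ) 1 →
      y' ∈ Set.Ico (0 : ℝ) 1 → (∀ n, gaussMap^[n] x ∈ Set.Ioc (0 : ℝ) (1 / 2)) →
      (∀ n, gaussMap^[n] x' ∈ Set.Ioc (0 : ℝ) (1 / 2)) →
      (∀ n, partialQuotient (n + 1) x = codedQuotient α y n) →
      (∀ n, partialQuotient (n + 1) x' = codedQuotient α y' n) →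
      dist y y' ≤ C * dist x x' ^ r := by
  have hα0 : 0 < α - 1 := sub_pos.2 hα
  have hα0' : α - 1 ≠ 0 := hα0.ne'
  have hα1' : 1 + α ≠ 0 := by linarith
  have hr1 : r < 1 := hr.trans (by rw [div_lt_one (by linarith)]; linarith)
  let c : ℝ := 1 / (1 + α)
  have hc : 0 < c := by positivity
  let u : ℕ → ℝ := fun i => c * α ^ (i + 1) + 2
  let l : ℕ → ℝ := fun i => c * α ^ (i + 1) - (i + 1)
  let Q : ℕ → ℝ := fun n => (1 - r) * u n - ∑ i ∈ Finset.range (n + 1), l i +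
    2 * r * ∑ i ∈ Finset.range (n + 1), u i
  have hQ : Tendsto Q atTop atBot := by
    have hκ : 0 < c * α * (1 - r * (1 + α)) / (α - 1) := by
      rw [lt_div_iff₀ (by linarith)] at hr
      have : 0 < 1 - r * (1 + α) := by linarith
      positivity
    refine (tendsto_quadratic_sub_exponential hα hκ
      ((1 - r) * 2 + 1 + 4 * r + (1 - 2 * r) * c * α / (α - 1)) (3 / 2 + 4 * r) (1 / 2)).congr
      fun n => ?_
    simp only [Q, l, u]
    rw [Finset.sum_sub_distrib, sum_range_cast_succ, Finset.sum_add_distrib, ← Finset.mul_sum,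
      sum_range_pow_succ hα, Finset.sum_const, Finset.card_range, nsmul_eq_mul]
    push_cast
    field_simp
    ring
  -- A sequence tending to `-∞` attains its maximum, which gives a constant independent of the first
  -- differing index.
  obtain ⟨k, hk⟩ := (Nat.cofinite_eq_atTop ▸ hQ :
    Tendsto Q cofinite atBot).exists_forall_ge
  refine ⟨⟨4 * Real.exp (Q k), by positivity⟩, fun x x' y y' hy hy' hx hx' hxy hxy' => ?_⟩
  rcases eq_or_ne y y' with rfl | hne
  · rw [dist_self]
    exact mul_nonneg (NNReal.coe_nonneg _) (by positivity)
  have hm : ∀ n, 2 ≤ choiceCount α n := fun n => by unfold choiceCount; omega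
  have hex := exists_radixDigit_ne hm hy hy' hne
  classical
  obtain ⟨n, hn, hlt⟩ : ∃ n, radixDigit (choiceCount α) y n ≠ radixDigit (choiceCount α) y' n ∧
      ∀ i < n, radixDigit (choiceCount α) y i = radixDigit (choiceCount α) y' i :=
    ⟨Nat.find hex, Nat.find_spec hex, fun i hi => not_not.1 (Nat.find_min hex hi)⟩
  set Δ : ℝ := |(radixDigit (choiceCount α) y n : ℝ) - radixDigit (choiceCount α) y' n| with hΔ
  have hΔ1 : 1 ≤ Δ := one_le_abs_natCast_sub hn
  have hΔ0 : 0 < Δ := by linarith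
  have hΔu : Δ ≤ Real.exp (u n) := by
    refine le_trans ?_ (choiceCount_le_exp hα n)
    have h1 : (radixDigit (choiceCount α) y n : ℝ) < choiceCount α n := by
      exact_mod_cast radixDigit_lt hy (by have := hm n; omega)
    have h2 : (radixDigit (choiceCount α) y' n : ℝ) < choiceCount α n := by
      exact_mod_cast radixDigit_lt hy' (by have := hm n; omega)
    rw [hΔ, abs_le]
    constructor <;> linarith [Nat.cast_nonneg (α := ℝ) (radixDigit (choiceCount α) y n),
      Nat.cast_nonneg (α := ℝ) (radixDigit (choiceCount α) y' n)]
  have hup : dist y y' ≤ 2 * Δ * Real.exp (-∑ i ∈ Finset.range (n + 1), l i) := by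
    have h1 := prod_mul_abs_sub_le hy hy' n hlt hn
    have h2 : Real.exp (∑ i ∈ Finset.range (n + 1), l i) ≤
        ∏ i ∈ Finset.range (n + 1), (choiceCount α i : ℝ) := by
      rw [Real.exp_sum]
      exact Finset.prod_le_prod (fun i _ => (Real.exp_pos _).le) fun i _ => exp_le_choiceCount i
    rw [Real.exp_neg, ← div_eq_mul_inv, le_div_iff₀ (Real.exp_pos _), mul_comm, Real.dist_eq]
    exact (mul_le_mul_of_nonneg_right h2 (abs_nonneg _)).trans h1
  have hlow : Δ / 2 * Real.exp (-2 * ∑ i ∈ Finset.range (n + 1), u i) ≤ dist x x' := by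
    have hxo : ∀ n, gaussMap^[n] x ∈ Set.Ioo (0 : ℝ) 1 := fun n =>
      ⟨(hx n).1, (hx n).2.trans_lt (by norm_num)⟩
    have hxo' : ∀ n, gaussMap^[n] x' ∈ Set.Ioo (0 : ℝ) 1 := fun n =>
      ⟨(hx' n).1, (hx' n).2.trans_lt (by norm_num)⟩
    have hcast : ∀ i, (partialQuotient (i + 1) x : ℝ) = codedQuotient α y i := fun i => by
      rw [hxy]; rfl
    have hcast' : ∀ i, (partialQuotient (i + 1) x' : ℝ) = codedQuotient α y' i := fun i => by
      rw [hxy']; rfl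
    have h1 := le_abs_sub_of_partialQuotient_eq (u := u) hxo hxo' n
      (fun i hi => by rw [hxy, hxy', codedQuotient, codedQuotient, hlt i hi])
      (fun i _ => by rw [hcast]; exact codedQuotient_add_one_le hα hy i)
    have hdiff : |(⌊1 / gaussMap^[n] x⌋ : ℝ) - ⌊1 / gaussMap^[n] x'⌋| = Δ := by
      rw [← partialQuotient_succ, ← partialQuotient_succ, hcast, hcast', codedQuotient,
        codedQuotient, hΔ]
      push_cast
      rw [add_sub_add_left_eq_sub]
    have h2 := abs_floor_sub_mul_le (u := u n) (hxo n) (hxo' n)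
      (by rw [← Function.iterate_succ_apply' gaussMap]; exact hx (n + 1))
      (by rw [← Function.iterate_succ_apply' gaussMap]; exact hx' (n + 1)) (by rw [hdiff]; exact hΔ1)
      (by rw [← partialQuotient_succ, hcast]; exact codedQuotient_add_one_le hα hy n)
      (by rw [← partialQuotient_succ, hcast']; exact codedQuotient_add_one_le hα hy' n)
    rw [hdiff] at h2
    rw [Real.dist_eq, Finset.sum_range_succ, mul_add, add_comm, Real.exp_add, ← mul_assoc]
    exact (mul_le_mul_of_nonneg_right h2 (Real.exp_pos _).le).trans h1
  have hlow' : Δ ^ r / 2 * Real.exp (-(2 * r * ∑ i ∈ Finset.range (n + 1), u i)) ≤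
      dist x x' ^ r := by
    refine le_trans ?_ (Real.rpow_le_rpow (by positivity) hlow hr0.le)
    rw [Real.mul_rpow (by positivity) (Real.exp_pos _).le, ← Real.exp_mul,
      Real.div_rpow hΔ0.le zero_le_two]
    have h2 : (2 : ℝ) ^ r ≤ 2 := by
      simpa using Real.rpow_le_rpow_of_exponent_le one_le_two hr1.le
    rw [show -2 * (∑ i ∈ Finset.range (n + 1), u i) * r =
      -(2 * r * ∑ i ∈ Finset.range (n + 1), u i) by ring]
    refine mul_le_mul_of_nonneg_right ?_ (Real.exp_pos _).le
    exact div_le_div_of_nonneg_left (by positivity) (by positivity) h2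
  have hΔr : Δ ≤ Δ ^ r * Real.exp ((1 - r) * u n) := by
    have h1 : Δ = Δ ^ r * Δ ^ (1 - r) := by
      rw [← Real.rpow_add hΔ0, add_sub_cancel, Real.rpow_one]
    have h2 : Δ ^ (1 - r) ≤ Real.exp ((1 - r) * u n) := by
      rw [mul_comm, Real.exp_mul]
      exact Real.rpow_le_rpow hΔ0.le hΔu (by linarith)
    calc Δ = Δ ^ r * Δ ^ (1 - r) := h1
      _ ≤ _ := mul_le_mul_of_nonneg_left h2 (by positivity)
  have hQn : Real.exp (Q n) ≤ Real.exp (Q k) := Real.exp_le_exp.2 (hk n)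
  have hsplit : Real.exp (Q n) * Real.exp (-(2 * r * ∑ i ∈ Finset.range (n + 1), u i)) =
      Real.exp ((1 - r) * u n) * Real.exp (-∑ i ∈ Finset.range (n + 1), l i) := by
    rw [← Real.exp_add, ← Real.exp_add]
    congr 1
    simp only [Q]
    ring
  calc dist y y' ≤ 2 * Δ * Real.exp (-∑ i ∈ Finset.range (n + 1), l i) := hup
    _ ≤ 2 * (Δ ^ r * Real.exp ((1 - r) * u n)) *
        Real.exp (-∑ i ∈ Finset.range (n + 1), l i) :=
      mul_le_mul_of_nonneg_right (mul_le_mul_of_nonneg_left hΔr zero_le_two) (Real.exp_pos _).le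
    _ = 4 * Real.exp (Q n) *
        (Δ ^ r / 2 * Real.exp (-(2 * r * ∑ i ∈ Finset.range (n + 1), u i))) := by
      linear_combination (-2 * Δ ^ r) * hsplit
    _ ≤ 4 * Real.exp (Q k) * dist x x' ^ r :=
      mul_le_mul (mul_le_mul_of_nonneg_left hQn (by norm_num)) hlow' (by positivity)
        (by positivity)

theorem le_dimH_growthSet (hα : 1 < α) :
    ENNReal.ofReal (1 / (1 + α)) ≤ dimH (growthSet (fun n : ℕ => Real.exp (α ^ n))) := by
  refine ENNReal.le_of_forall_nnreal_lt fun r hr => ?_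
  rcases eq_or_lt_of_le (zero_le (a := r)) with rfl | hr0
  · simp
  have hr' : (r : ℝ) < 1 / (1 + α) := by
    rw [← ENNReal.ofReal_coe_nnreal] at hr
    exact lt_of_not_ge fun h => absurd (ENNReal.ofReal_le_ofReal h) hr.not_ge
  choose g hg1 hg2 using fun y : ℝ =>
    exists_partialQuotient_eq (codedQuotient α y) (two_le_codedQuotient hα y)
  obtain ⟨C, hC⟩ := dist_le_of_partialQuotient_eq hα (NNReal.coe_pos.2 hr0) hr'
  have h1 : dimH (Set.Ico (0 : ℝ) 1) ≤ dimH (g '' Set.Ico (0 : ℝ) 1) / r :=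
    dimH_le_dimH_image_div hr0 fun y hy y' hy' =>
      hC (g y) (g y') y y' hy hy' (hg1 y) (hg1 y') (hg2 y) (hg2 y')
  rw [Real.dimH_of_nonempty_interior (by simp), Module.finrank_self, Nat.cast_one,
    ENNReal.le_div_iff_mul_le (Or.inl (by exact_mod_cast hr0.ne')) (Or.inl ENNReal.coe_ne_top),
    one_mul] at h1
  refine h1.trans (dimH_mono ?_)
  rintro _ ⟨y, hy, rfl⟩
  exact mem_growthSet_of_partialQuotient_eq hα hy (hg1 y) (hg2 y)

end

theorem theorem1p7 (α : ℝ) (hα : 1 < α) :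
    dimH (growthSet (fun n : ℕ => Real.exp (α ^ n))) = ENNReal.ofReal (1 / (1 + α)) :=
  le_antisymm (dimH_growthSet_le hα) (le_dimH_growthSet hα)
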